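/- For a number field $K$ with set of places $M_K$ and $v\in M_K$, let $\|\cdot\|_v$ be the absolute value on $K$ that extends the usual archimedean or $\ell$-adic absolute value of $\mathbb{Q}$. For $\alpha\in K^\times$ put $$h_p(\alpha)=\Big(\sum_{v\in M_K}\tfrac{[K_v:\mathbb{Q}_v]}{[K:\mathbb{Q}]}\,\big|\log\|\alpha\|_v\big|^p\Big)^{1/p}\ (1\le p<\infty),\qquad h_\infty(\alpha)=\sup_{v\in M_K}\big|\log\|\alpha\|_v\big|,$$ and let $h(\alpha)=\sum_{v}\tfrac{[K_v:\mathbb{Q}_v]}{[K:\mathbb{Q}]}\log^+\|\alpha\|_v$ be the absolute logarithmic Weil height; none of these depends on the choice of $K\ni\alpha$. For $\alpha\in\overline{\mathbb{Q}}^\times$ put $m_p(\alpha)=(\deg\alpha)\,h_p(\alpha)$. Let $\mathcal{G}=\overline{\mathbb{Q}}^\times/\operatorname{Tor}(\overline{\mathbb{Q}}^\times)$, a $\mathbb{Q}$-vector space written multiplicatively. For $\boldsymbol{\alpha}\in\mathcal{G}$ let $d(\boldsymbol{\alpha})$ be the least degree of a representative, let $h_p(\boldsymbol{\alpha})$ be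 the common value of $h_p$ at all representatives, put $m_p(\boldsymbol{\alpha})=d(\boldsymbol{\alpha})h_p(\boldsymbol{\alpha})$, and define the extremal norm $$\widetilde m_p(\boldsymbol{\alpha})=\inf\Big\{\sum_{i=1}^n|r_i|\,m_p(\boldsymbol{\alpha}_i)\;:\;\boldsymbol{\alpha}=\boldsymbol{\alpha}_1^{r_1}\cdots\boldsymbol{\alpha}_n^{r_n},\ \boldsymbol{\alpha}_i\in\mathcal{G},\ r_i\in\mathbb{Q}\Big\}.$$ Let $\mathcal{A}\subset\mathcal{G}$ be the set of $\boldsymbol{\alpha}\ne\boldsymbol{1}$ that have a representative $\alpha$ such that (i) $\alpha$ is an algebraic unit, (ii) $[\mathbb{Q}(\alpha^n):\mathbb{Q}]=[\mathbb{Q}(\alpha):\mathbb{Q}]$ for all integers $n\ge1$, and (iii) for every proper subfield $F$ of $K=\mathbb{Q}(\alpha)$, the norm $\operatorname{Norm}^K_F(\alpha)$ is a root of unity. Theorem. Let $1\le p\le\infty$. If there is a constant $c_p$ such that $\widetilde m_p(\boldsymbol{\alpha})\ge c_p>0$ for all $\boldsymbol{\alpha}\in\mathcal{A}$, then there is a constant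 $c_p'$ such that $m_p(\alpha)\ge c_p'>0$ for all $\alpha\in\overline{\mathbb{Q}}^\times\setminus\operatorname{Tor}(\overline{\mathbb{Q}}^\times)$. In particular, the hypothesis for $p=1$ implies Lehmer's conjecture: there is $c>0$ such that $(\deg\alpha)\,h(\alpha)\ge c$ for all $\alpha\in\overline{\mathbb{Q}}^\times\setminus\operatorname{Tor}(\overline{\mathbb{Q}}^\times)$. The hypothesis for $p=\infty$ implies the Schinzel–Zassenhaus conjecture: there is $c>0$ such that every algebraic integer $\alpha\ne0$ that is not a root of unity has a conjugate in $\mathbb{C}$ of absolute value at least $1+c/\deg\alpha$. -/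

import Mathlib

open scoped ENNReal IntermediateField

noncomputable section

namespace ExtremalNorm

/-! ## Places of a number field, and heights -/

section Heights

variable (K : Type*) [Field K] [NumberField K]

/-- The set `M_K` of places of the number field `K`. -/
abbrev Place : Type _ := NumberField.InfinitePlace K ⊕ NumberField.FinitePlace K

variable {K}

/-- The local degree `[K_v : ℚ_v]`: it is `1` or `2` for a real or complex place, and the product
`e * f` of the ramification index and the inertia degree (over `ℤ`) for a finite place. -/
def Place.localDegree : Place K → ℕ
  | Sum.inl v => v.mult
  | Sum.inr v => v.maximalIdeal.asIdeal.ramificationIdx ℤ * v.maximalIdeal.asIdeal.inertiaDeg ℤ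

/-- The absolute value `‖x‖_v` that extends the usual archimedean or `p`-adic absolute value
of `ℚ`. Mathlib normalizes the absolute value of a finite place `v` by `|x|_v = N(v) ^ (-ord_v x)`,
which is the `[K_v : ℚ_v]`-th power of the one that extends the `p`-adic one. -/
def Place.abv : Place K → K → ℝ
  | Sum.inl v, x => v x
  | Sum.inr v, x => (v x) ^ ((Place.localDegree (Sum.inr v) : ℝ)⁻¹)

/-- The `L^p` Weil height of `x ∈ K`, computed in the number field `K`:
`(∑_v [K_v : ℚ_v] / [K : ℚ] * |log ‖x‖_v| ^ p) ^ (1 / p)` for `p < ∞`, and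
`sup_v |log ‖x‖_v|` for `p = ∞`. For `x ≠ 0` only finitely many terms are nonzero. -/
def heightIn (p : ℝ≥0∞) (x : K) : ℝ :=
  if p = ∞ then ⨆ v : Place K, |Real.log (v.abv x)|
  else (∑ᶠ v : Place K, (v.localDegree : ℝ) / (Module.finrank ℚ K : ℝ) *
      |Real.log (v.abv x)| ^ p.toReal) ^ (p.toReal)⁻¹

/-- The absolute logarithmic Weil height of `x ∈ K`, computed in the number field `K`:
`∑_v [K_v : ℚ_v] / [K : ℚ] * log⁺ ‖x‖_v`. -/
def weilHeightIn (x : K) : ℝ :=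
  ∑ᶠ v : Place K, (v.localDegree : ℝ) / (Module.finrank ℚ K : ℝ) * Real.posLog (v.abv x)

end Heights

/-- The field of algebraic numbers. -/
abbrev Qbar : Type := AlgebraicClosure ℚ

instance : Algebra.IsAlgebraic ℚ Qbar := AlgebraicClosure.isAlgebraic ℚ

instance numberFieldAdjoin (α : Qbar) : NumberField ℚ⟮α⟯ where
  to_charZero := inferInstance
  to_finiteDimensional :=
    IntermediateField.adjoin.finiteDimensional (Algebra.IsIntegral.isIntegral α)

/-- `deg α = [ℚ(α) : ℚ]`. -/
def deg (α : Qbar) : ℕ := Module.finrank ℚ ℚ⟮α⟯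

/-- The `L^p` Weil height `h_p(α)`. It does not depend on the number field containing `α` in which
it is computed; here that field is `ℚ(α)`. -/
def height (p : ℝ≥0∞) (α : Qbarˣ) : ℝ :=
  heightIn p (IntermediateField.AdjoinSimple.gen ℚ (α : Qbar))

/-- The absolute logarithmic Weil height `h(α)`. -/
def weilHeight (α : Qbarˣ) : ℝ :=
  weilHeightIn (IntermediateField.AdjoinSimple.gen ℚ (α : Qbar))

/-- The `L^p` Mahler measure `m_p(α) = (deg α) * h_p(α)`. -/
def mahler (p : ℝ≥0∞) (α : Qbarˣ) : ℝ := (deg (α : Qbar) : ℝ) * height p α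

/-- The house of `α`: the largest modulus of a conjugate of `α` in `ℂ`. -/
def house (α : Qbar) : ℝ := NumberField.house (IntermediateField.AdjoinSimple.gen ℚ α)

/-! ## Algebraic numbers modulo torsion -/

/-- The group `𝒢` of nonzero algebraic numbers modulo roots of unity, written additively. -/
abbrev AlgModTors : Type := Additive (Qbarˣ ⧸ CommGroup.torsion Qbarˣ)

/-- The class of `α` modulo torsion. -/
def cls (α : Qbarˣ) : AlgModTors := Additive.ofMul (QuotientGroup.mk α)

theorem exists_nsmul_eq (n : ℕ) (hn : n ≠ 0) (a : AlgModTors) : ∃ b : AlgModTors, n • b = a := by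
  obtain ⟨α, hα⟩ := QuotientGroup.mk_surjective (Additive.toMul a)
  obtain ⟨z, hz⟩ := IsAlgClosed.exists_pow_nat_eq (α : Qbar) (Nat.pos_of_ne_zero hn)
  have hz0 : z ≠ 0 := by
    rintro rfl
    rw [zero_pow hn] at hz
    exact α.ne_zero hz.symm
  refine ⟨cls (Units.mk0 z hz0), ?_⟩
  have h : (Units.mk0 z hz0) ^ n = α := Units.ext (by simpa using hz)
  calc n • cls (Units.mk0 z hz0) = cls ((Units.mk0 z hz0) ^ n) := rfl
    _ = a := by rw [h]; exact congrArg Additive.ofMul hα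

/-- The unique `b` with `n b = a`, for `n ≠ 0` (that is, the `n`-th root of the class `a`). -/
def divNat (a : AlgModTors) (n : ℕ) : AlgModTors :=
  if hn : n = 0 then 0 else (exists_nsmul_eq n hn a).choose

theorem nsmul_divNat (a : AlgModTors) {n : ℕ} (hn : n ≠ 0) : n • divNat a n = a := by
  rw [divNat, dif_neg hn]
  exact (exists_nsmul_eq n hn a).choose_spec

theorem nsmul_inj {n : ℕ} (hn : n ≠ 0) {a b : AlgModTors} (h : n • a = n • b) : a = b :=
  nsmul_right_injective hn h

/-- Multiplication by a rational number on `𝒢`; multiplicatively, `a ↦ a ^ r`. -/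
instance : SMul ℚ AlgModTors := ⟨fun r a => divNat (r.num • a) r.den⟩

theorem den_nsmul_smul (r : ℚ) (a : AlgModTors) : r.den • (r • a) = r.num • a :=
  nsmul_divNat _ r.den_ne_zero

theorem smul_eq_of {r : ℚ} {a b : AlgModTors} {n : ℕ} {m : ℤ} (hn : n ≠ 0) (hr : r * n = m)
    (h : n • b = m • a) : r • a = b := by
  have h1 : r.num * (n : ℤ) = m * (r.den : ℤ) := by
    have h2 : (r.num : ℚ) = r * r.den := (Rat.mul_den_eq_num r).symm
    have : (r.num : ℚ) * n = m * r.den := by rw [h2, ← hr]; ring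
    exact_mod_cast this
  apply nsmul_inj (mul_ne_zero hn r.den_ne_zero)
  calc (n * r.den) • (r • a) = (r.num * (n : ℤ)) • a := by
        rw [mul_nsmul', den_nsmul_smul, mul_comm r.num, mul_zsmul, natCast_zsmul]
    _ = (n * r.den) • b := by
        rw [h1, mul_comm n, mul_nsmul', h, mul_comm m, mul_zsmul, natCast_zsmul]

/-- The `ℚ`-vector space structure on `𝒢`. -/
instance : Module ℚ AlgModTors where
  one_smul a := smul_eq_of one_ne_zero (n := 1) (m := 1) (by simp) (by simp)
  mul_smul r s a := by
    refine smul_eq_of (n := r.den * s.den) (m := r.num * s.num)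
      (mul_ne_zero r.den_ne_zero s.den_ne_zero) ?_ ?_
    · push_cast
      rw [← Rat.mul_den_eq_num r, ← Rat.mul_den_eq_num s]; ring
    · rw [mul_comm r.den, mul_nsmul', den_nsmul_smul, mul_zsmul, ← natCast_zsmul,
        ← mul_zsmul, mul_comm _ r.num, mul_zsmul, natCast_zsmul, den_nsmul_smul]
  smul_zero r := smul_eq_of (n := r.den) (m := r.num) r.den_ne_zero (Rat.mul_den_eq_num r)
    (by simp)
  zero_smul a := smul_eq_of one_ne_zero (n := 1) (m := 0) (by simp) (by simp)
  smul_add r a b := smul_eq_of (n := r.den) (m := r.num) r.den_ne_zero (Rat.mul_den_eq_num r)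
    (by rw [nsmul_add, den_nsmul_smul, den_nsmul_smul, zsmul_add])
  add_smul r s a := by
    refine smul_eq_of (n := r.den * s.den) (m := s.den * r.num + r.den * s.num)
      (mul_ne_zero r.den_ne_zero s.den_ne_zero) ?_ ?_
    · push_cast
      rw [← Rat.mul_den_eq_num r, ← Rat.mul_den_eq_num s]; ring
    · rw [nsmul_add, mul_nsmul' (s • a), den_nsmul_smul, mul_comm r.den, mul_nsmul' (r • a),
        den_nsmul_smul, add_zsmul, mul_zsmul, mul_zsmul, natCast_zsmul, natCast_zsmul]

/-- `d(a)`: the least degree of a representative of the class `a`. -/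
def minDeg (a : AlgModTors) : ℕ := sInf {n | ∃ α : Qbarˣ, cls α = a ∧ deg (α : Qbar) = n}

/-- The `L^p` Weil height of a class: the value of `h_p` at a representative. The representative
does not matter, since `h_p` is constant on classes modulo torsion. -/
def clsHeight (p : ℝ≥0∞) (a : AlgModTors) : ℝ := height p (Quotient.out (Additive.toMul a))

/-- The minimal logarithmic `L^p` Mahler measure `m_p(a) = d(a) * h_p(a)` on `𝒢`. -/
def minMahler (p : ℝ≥0∞) (a : AlgModTors) : ℝ := (minDeg a : ℝ) * clsHeight p a

/-- The norm height associated to `f : 𝒢 → [0, ∞)`: the infimum of `∑ |r_i| f(a_i)` over all ways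
of writing `a` as a linear combination `∑ r_i a_i` (multiplicatively, `∏ a_i ^ r_i`). -/
def normHeight (f : AlgModTors → ℝ) (a : AlgModTors) : ℝ :=
  sInf {s : ℝ | ∃ (n : ℕ) (r : Fin n → ℚ) (b : Fin n → AlgModTors),
    a = ∑ i, r i • b i ∧ s = ∑ i, |(r i : ℝ)| * f (b i)}

/-- The extremal norm `m̃_p` on `𝒢`. -/
def extremalNorm (p : ℝ≥0∞) : AlgModTors → ℝ := normHeight (minMahler p)

/-- The set `𝒜` of nontrivial classes that have a representative `α` such that `α` is an algebraic
unit, `[ℚ(α ^ n) : ℚ] = [ℚ(α) : ℚ]` for all `n ≥ 1`, and the norm of `α` from `ℚ(α)` to any proper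
subfield is a root of unity. -/
def setA : Set AlgModTors :=
  {a | a ≠ 0 ∧ ∃ α : Qbarˣ, cls α = a ∧
    (IsIntegral ℤ (α : Qbar) ∧ IsIntegral ℤ ((α⁻¹ : Qbarˣ) : Qbar)) ∧
    (∀ n : ℕ, 1 ≤ n → deg ((α : Qbar) ^ n) = deg (α : Qbar)) ∧
    (∀ F : IntermediateField ℚ ℚ⟮(α : Qbar)⟯, F ≠ ⊤ →
      IsOfFinOrder (Algebra.norm F (IntermediateField.AdjoinSimple.gen ℚ (α : Qbar))))}

/-! ## The lower bounds -/

/-- `m̃_p` is bounded away from zero on `𝒜`. -/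
def ExtremalBound (p : ℝ≥0∞) : Prop :=
  ∃ c : ℝ, 0 < c ∧ ∀ a ∈ setA, c ≤ extremalNorm p a

/-- The `L^p` Lehmer bound: `m_p` is bounded away from zero on the algebraic numbers that are
neither zero nor a root of unity. -/
def LpLehmerBound (p : ℝ≥0∞) : Prop :=
  ∃ c : ℝ, 0 < c ∧ ∀ α : Qbarˣ, α ∉ CommGroup.torsion Qbarˣ → c ≤ mahler p α

/-- Lehmer's conjecture: the logarithmic Mahler measure `(deg α) * h(α)` is bounded away from zero
on the algebraic numbers that are neither zero nor a root of unity. -/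
def LehmerConjecture : Prop :=
  ∃ c : ℝ, 0 < c ∧ ∀ α : Qbarˣ, α ∉ CommGroup.torsion Qbarˣ →
    c ≤ (deg (α : Qbar) : ℝ) * weilHeight α

/-- The Schinzel–Zassenhaus conjecture: for some absolute constant `c > 0`, every algebraic integer
`α` that is neither zero nor a root of unity has a conjugate of modulus at least
`1 + c / deg α`. -/
def SchinzelZassenhausConjecture : Prop :=
  ∃ c : ℝ, 0 < c ∧ ∀ α : Qbarˣ, IsIntegral ℤ (α : Qbar) → α ∉ CommGroup.torsion Qbarˣ →
    1 + c / (deg (α : Qbar) : ℝ) ≤ house (α : Qbar)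

end ExtremalNorm

end

/-!
Let `α` be a unit that is not a root of unity, let `K = ℚ(α)`, and choose a subfield `F` of `K`
minimal among those for which `b = Norm^K_F α` is not a root of unity. By transitivity of the norm,
the norms of `b` to the proper subfields of `F` are roots of unity. Since the norm of `b ^ n` from
`F` to `ℚ(b ^ n)` is a power of `b ^ n`, this forces `ℚ(b ^ n) = F` for all `n ≥ 1`, so the class of
`b` lies in `𝒜`. For a unit, `h_p` is the `L^p` mean of `log ‖σ α‖` over the embeddings `σ : K → ℂ`,
and `log ‖σ b‖` is a sum over the `[K : F]` extensions of `σ` to `K`; the power mean inequality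
gives `h_p b ≤ [K : F] * h_p α`, that is, `m_p b ≤ m_p α`. If `α` is not a unit, a single finite
place already contributes `log 2` to `m_p α`.

For Lehmer's conjecture, `h_1 = 2 * h` by the product formula. For the Schinzel–Zassenhaus
conjecture, let `α` be an algebraic integer of degree `d`. If it is not a unit, then
`house α ^ d ≥ |Norm α| ≥ 2`. If it is a unit conjugate to `α⁻¹`, then `h_∞ α ≤ log (house α)`.
Otherwise its minimal polynomial `P` is not a constant multiple of its reversal `P*`, and its Mahler
measure satisfies `M ^ 2 ≥ 5 / 4`: the integral power series `P / P*` is a quotient `f / g` of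
functions of `H²` norm at most `1` on the unit disc (finite Blaschke products, up to constants) with
`|f(0)| = |g(0)| = 1 / M`, and the bound comes from comparing the first nonconstant coefficient of
`f / g`, an integer, with those of `f` and `g`.
-/

noncomputable section

namespace ExtremalNorm

section NormIrreducible

open IntermediateField

variable (k : Type*) {K L : Type*} [Field k] [Field K] [Field L] [Algebra k K] [Algebra k L]

/-- `x` is norm-irreducible over `k` when its norm to every proper subextension of `K / k` is a root
of unity. -/
def IsNormIrreducible (x : K) : Prop :=
  ∀ F : IntermediateField k K, F ≠ ⊤ → IsOfFinOrder (Algebra.norm F x)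

theorem isOfFinOrder_map_iff {M N : Type*} [Field M] [Field N] (f : M →+* N) {x : M} :
    IsOfFinOrder (f x) ↔ IsOfFinOrder x :=
  Function.Injective.isOfFinOrder_iff (f := f.toMonoidHom) f.injective

variable {k}

theorem exists_isNormIrreducible_norm [FiniteDimensional k K] {x : K} (hx : ¬ IsOfFinOrder x) :
    ∃ F : IntermediateField k K, ¬ IsOfFinOrder (Algebra.norm F x) ∧
      IsNormIrreducible k (Algebra.norm F x) := by
  have : WellFoundedLT (IntermediateField k K) :=
    StrictMono.wellFoundedLT
      (f := fun F : IntermediateField k K => Subalgebra.toSubmodule F.toSubalgebra) fun _ _ h => h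
  have htop : ¬ IsOfFinOrder (Algebra.norm (⊤ : IntermediateField k K) x) := by
    rw [← Algebra.norm_eq_of_ringEquiv (topEquiv (F := k) (E := K)).symm.toRingEquiv rfl,
      Algebra.norm_self]
    exact fun h => hx ((isOfFinOrder_map_iff
      (topEquiv (F := k) (E := K)).symm.toRingEquiv.toRingHom).mp h)
  obtain ⟨F, hF, hmin⟩ := wellFounded_lt.has_min
    {F : IntermediateField k K | ¬ IsOfFinOrder (Algebra.norm F x)} ⟨⊤, htop⟩
  refine ⟨F, hF, fun E hE => ?_⟩
  have hlt : lift E < F := by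
    refine (lift_le E).lt_of_ne fun h => hE ?_
    rwa [← lift_inj, lift_top]
  have hlift : IsOfFinOrder (Algebra.norm (lift E) x) := not_not.mp fun h => hmin _ h hlt
  rw [Algebra.norm_norm]
  rw [← Algebra.norm_eq_of_ringEquiv (liftAlgEquiv E).toRingEquiv rfl] at hlift
  exact (isOfFinOrder_map_iff (liftAlgEquiv E).toRingEquiv.toRingHom).mp hlift

theorem IsNormIrreducible.adjoin_pow_eq_top [FiniteDimensional k K] {x : K}
    (hx : IsNormIrreducible k x) (htor : ¬ IsOfFinOrder x) {n : ℕ} (hn : n ≠ 0) :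
    k⟮x ^ n⟯ = ⊤ := by
  by_contra hne
  have hnorm : Algebra.norm k⟮x ^ n⟯ (x ^ n) =
      AdjoinSimple.gen k (x ^ n) ^ Module.finrank k⟮x ^ n⟯ K :=
    Algebra.norm_algebraMap (AdjoinSimple.gen k (x ^ n))
  have hgen : IsOfFinOrder (AdjoinSimple.gen k (x ^ n)) := by
    refine IsOfFinOrder.of_pow (n := Module.finrank k⟮x ^ n⟯ K) ?_ Module.finrank_pos.ne'
    rw [← hnorm, map_pow]
    exact (hx _ hne).pow
  have hpow : IsOfFinOrder (x ^ n) := (isOfFinOrder_map_iff (algebraMap k⟮x ^ n⟯ K)).mpr hgen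
  exact htor (hpow.of_pow hn)

theorem IsNormIrreducible.map_algEquiv {x : K} (hx : IsNormIrreducible k x) (e : K ≃ₐ[k] L) :
    IsNormIrreducible k (e x) := fun F hF => by
  have hne : F.map (e.symm : L →ₐ[k] K) ≠ ⊤ := fun h => hF <| by
    rw [← comap_map (e.symm : L →ₐ[k] K) F, h]
    rfl
  let e' := (F.equivMap (e.symm : L →ₐ[k] K)).toRingEquiv
  rw [Algebra.norm_eq_of_equiv_equiv e' e.symm.toRingEquiv (by ext; rfl)]
  refine (isOfFinOrder_map_iff e'.symm.toRingHom).mpr ?_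
  simpa using hx _ hne

theorem exists_algEquiv_adjoin_map {x : K} (hx : k⟮x⟯ = ⊤) (f : K →ₐ[k] L) :
    ∃ e : K ≃ₐ[k] k⟮f x⟯, e x = AdjoinSimple.gen k (f x) := by
  have h : (⊤ : IntermediateField k K).map f = k⟮f x⟯ := by
    rw [← hx, adjoin_map, Set.image_singleton]
  exact ⟨(topEquiv.symm.trans (equivMap ⊤ f)).trans (equivOfEq h), rfl⟩

end NormIrreducible

section LpMean

variable {ι κ : Type*} [Fintype ι] [Fintype κ] {p : ℝ≥0∞}

/-- The `L^p` mean of a finite family of real numbers: its `L^p` norm for the uniform probability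
measure on the index type. The height of a unit is such a mean over the complex embeddings. -/
def lpMean (p : ℝ≥0∞) (f : ι → ℝ) : ℝ :=
  if p = ∞ then ⨆ i, |f i| else ((∑ i, |f i| ^ p.toReal) / Fintype.card ι) ^ (p.toReal)⁻¹

theorem lpMean_top (f : ι → ℝ) : lpMean ∞ f = ⨆ i, |f i| := if_pos rfl

theorem lpMean_of_ne_top (hp : p ≠ ∞) (f : ι → ℝ) :
    lpMean p f = ((∑ i, |f i| ^ p.toReal) / Fintype.card ι) ^ (p.toReal)⁻¹ := if_neg hp

theorem abs_le_lpMean_top (f : ι → ℝ) (i : ι) : |f i| ≤ lpMean ∞ f := by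
  rw [lpMean_top]
  exact le_ciSup (f := fun i => |f i|) (Set.finite_range _).bddAbove i

theorem lpMean_top_le {f : ι → ℝ} {B : ℝ} (hB : 0 ≤ B) (h : ∀ i, |f i| ≤ B) : lpMean ∞ f ≤ B := by
  rw [lpMean_top]
  exact Real.iSup_le h hB

variable [DecidableEq κ] {g : ι → κ} {n : ℕ}

theorem card_eq_mul_card_of_card_fiber (hg : ∀ j, Finset.card {i | g i = j} = n) :
    Fintype.card ι = n * Fintype.card κ := by
  rw [← Finset.card_univ,
    Finset.card_eq_sum_card_fiberwise (f := g) (t := Finset.univ) fun _ _ => Finset.mem_univ _]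
  simp only [hg, Finset.sum_const, Finset.card_univ, smul_eq_mul, mul_comm]

theorem sum_comp_of_card_fiber (hg : ∀ j, Finset.card {i | g i = j} = n) (f : κ → ℝ) :
    ∑ i, f (g i) = n * ∑ j, f j := by
  rw [← Finset.sum_fiberwise' Finset.univ g f, Finset.mul_sum]
  simp only [Finset.sum_const, hg, nsmul_eq_mul]

theorem lpMean_comp (hn : n ≠ 0) (hg : ∀ j, Finset.card {i | g i = j} = n) (f : κ → ℝ) :
    lpMean p (f ∘ g) = lpMean p f := by
  rcases eq_or_ne p ∞ with rfl | hp
  · have hsurj : Function.Surjective g := fun j => by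
      obtain ⟨i, hi⟩ := Finset.card_pos.mp ((hg j).symm ▸ Nat.pos_of_ne_zero hn)
      exact ⟨i, (Finset.mem_filter.mp hi).2⟩
    rw [lpMean_top, lpMean_top]
    exact hsurj.iSup_comp fun j => |f j|
  · rw [lpMean_of_ne_top hp, lpMean_of_ne_top hp, card_eq_mul_card_of_card_fiber hg, Nat.cast_mul]
    have hsum := sum_comp_of_card_fiber hg fun j => |f j| ^ p.toReal
    simp only [Function.comp_apply]
    rw [hsum, mul_div_mul_left _ _ (Nat.cast_ne_zero.mpr hn)]

theorem sum_abs_sum_fiber_rpow_le {q : ℝ} (hq : 1 ≤ q) (hg : ∀ j, Finset.card {i | g i = j} = n)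
    (f : ι → ℝ) : ∑ j, |∑ i with g i = j, f i| ^ q ≤ (n : ℝ) ^ (q - 1) * ∑ i, |f i| ^ q := by
  rw [← Finset.univ.sum_fiberwise g, Finset.mul_sum]
  refine Finset.sum_le_sum fun j _ => ?_
  calc |∑ i with g i = j, f i| ^ q ≤ (∑ i with g i = j, |f i|) ^ q :=
        Real.rpow_le_rpow (abs_nonneg _) (Finset.abs_sum_le_sum_abs _ _) (by linarith)
    _ ≤ (n : ℝ) ^ (q - 1) * ∑ i with g i = j, |f i| ^ q := by
        simpa only [hg j] using Real.rpow_sum_le_const_mul_sum_rpow {i | g i = j} f hq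

theorem one_le_toReal (h1 : 1 ≤ p) (hp : p ≠ ∞) : 1 ≤ p.toReal := by
  simpa using ENNReal.toReal_mono hp h1

theorem lpMean_sum_fiber_le (hp1 : 1 ≤ p) (hn : n ≠ 0)
    (hg : ∀ j, Finset.card {i | g i = j} = n) (f : ι → ℝ) :
    lpMean p (fun j => ∑ i with g i = j, f i) ≤ n * lpMean p f := by
  rcases eq_or_ne p ∞ with rfl | hp
  · refine lpMean_top_le (mul_nonneg n.cast_nonneg ?_) fun j => ?_
    · rw [lpMean_top]
      exact Real.iSup_nonneg fun _ => abs_nonneg _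
    · rw [← hg j, ← nsmul_eq_mul]
      exact (Finset.abs_sum_le_sum_abs _ _).trans
        (Finset.sum_le_card_nsmul _ _ _ fun i _ => abs_le_lpMean_top f i)
  · have hq := one_le_toReal hp1 hp
    have hn0 : (0 : ℝ) < n := by exact_mod_cast Nat.pos_of_ne_zero hn
    rw [lpMean_of_ne_top hp, lpMean_of_ne_top hp]
    set q := p.toReal
    have hq0 : 0 < q := by linarith
    calc ((∑ j, |∑ i with g i = j, f i| ^ q) / Fintype.card κ) ^ q⁻¹
        ≤ ((n : ℝ) ^ (q - 1) * (∑ i, |f i| ^ q) / Fintype.card κ) ^ q⁻¹ := by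
          gcongr
          exact sum_abs_sum_fiber_rpow_le hq hg f
      _ = ((n : ℝ) ^ q * ((∑ i, |f i| ^ q) / Fintype.card ι)) ^ q⁻¹ := by
          rw [card_eq_mul_card_of_card_fiber hg, Real.rpow_sub_one hn0.ne']
          push_cast
          congr 1
          field_simp
      _ = n * ((∑ i, |f i| ^ q) / Fintype.card ι) ^ q⁻¹ := by
          rw [Real.mul_rpow (by positivity) (by positivity), Real.rpow_rpow_inv hn0.le hq0.ne']

end LpMean

section Extensions

open NumberField

variable {K L : Type*} [Field K] [Field L] [Algebra K L]

/-- The extensions to `L` of a complex embedding `σ` of `K`, as the homomorphisms `L → ℂ` of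
`K`-algebras, where `K` acts on `ℂ` through `σ`. -/
def extensionEquivAlgHom (σ : K →+* ℂ) :
    letI := σ.toAlgebra
    {τ : L →+* ℂ // τ.comp (algebraMap K L) = σ} ≃ (L →ₐ[K] ℂ) :=
  letI := σ.toAlgebra
  { toFun τ := { τ.1 with commutes' := RingHom.congr_fun τ.2 }
    invFun φ := ⟨φ.toRingHom, φ.comp_algebraMap⟩ }

variable [NumberField K] [NumberField L]

open scoped Classical in
theorem card_extensions (σ : K →+* ℂ) :
    Finset.card {τ : L →+* ℂ | τ.comp (algebraMap K L) = σ} = Module.finrank K L := by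
  have : FiniteDimensional K L := .of_restrictScalars_finite ℚ K L
  let := σ.toAlgebra
  rw [← Fintype.card_subtype, Fintype.card_congr (extensionEquivAlgHom σ), AlgHom.card]

open scoped Classical in
theorem map_norm_eq_prod_extensions (σ : K →+* ℂ) (x : L) :
    σ (Algebra.norm K x) = ∏ τ : L →+* ℂ with τ.comp (algebraMap K L) = σ, τ x := by
  have : FiniteDimensional K L := .of_restrictScalars_finite ℚ K L
  let := σ.toAlgebra
  rw [Finset.prod_subtype (p := fun τ : L →+* ℂ => τ.comp (algebraMap K L) = σ)
    (F := inferInstance) _ (by simp)]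
  exact (Algebra.norm_eq_prod_embeddings K ℂ x).trans
    (Fintype.prod_equiv (extensionEquivAlgHom σ).symm _ _ fun _ => rfl)

end Extensions

section Places

open NumberField Module

variable {K : Type*} [Field K] [NumberField K]

theorem finsum_sum_eq_add {α β M : Type*} [Fintype α] [AddCommMonoid M] {f : α ⊕ β → M}
    (hf : (Function.support fun b => f (Sum.inr b)).Finite) :
    ∑ᶠ v, f v = ∑ a, f (Sum.inl a) + ∑ᶠ b, f (Sum.inr b) := by
  rw [finsum_eq_sum_of_support_subset (s := Finset.univ.disjSum hf.toFinset), Finset.sum_disjSum,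
    finsum_eq_sum _ hf]
  rintro (a | b) h
  · simp
  · simpa using h

theorem localDegree_finite_pos (v : FinitePlace K) : 0 < Place.localDegree (Sum.inr v) :=
  Nat.mul_pos (Ideal.ramificationIdx_pos _ _) (Ideal.inertiaDeg_pos _ _)

theorem localDegree_le_finrank : ∀ v : Place K, v.localDegree ≤ finrank ℚ K
  | Sum.inl v => by
    rw [← InfinitePlace.sum_mult_eq]
    exact Finset.single_le_sum (f := InfinitePlace.mult) (fun _ _ => Nat.zero_le _)
      (Finset.mem_univ v)
  | Sum.inr v => by
    set q := v.maximalIdeal.asIdeal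
    have : q.IsMaximal := v.maximalIdeal.isMaximal
    have : (q.under ℤ).IsMaximal := inferInstance
    have : Fintype ((q.under ℤ).primesOver (𝓞 K)) :=
      (IsDedekindDomain.primesOver_finite (q.under ℤ) (𝓞 K)).fintype
    rw [← RingOfIntegers.rank K, ← Ideal.sum_ramification_inertia_eq_finrank (q.under ℤ) (𝓞 K)]
    exact Finset.single_le_sum
      (f := fun q' : (q.under ℤ).primesOver (𝓞 K) => q'.1.ramificationIdx ℤ * q'.1.inertiaDeg ℤ)
      (fun _ _ => Nat.zero_le _) (Finset.mem_univ ⟨q, inferInstance, ⟨rfl⟩⟩)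

theorem localDegree_mul_log_abv_finite (v : FinitePlace K) {x : K} (hx : x ≠ 0) :
    Place.localDegree (Sum.inr v) * Real.log (Place.abv (Sum.inr v) x) = Real.log (v x) := by
  have : (Place.localDegree (Sum.inr v) : ℝ) ≠ 0 := by
    exact_mod_cast (localDegree_finite_pos v).ne'
  rw [Place.abv, Real.log_rpow (FinitePlace.pos_iff.mpr hx), mul_inv_cancel_left₀ this]

theorem abv_finite_eq_one {v : FinitePlace K} {x : K} (h : v x = 1) :
    Place.abv (Sum.inr v) x = 1 := by
  rw [Place.abv, h, Real.one_rpow]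

theorem finite_log_abv_ne_zero {x : K} (hx : x ≠ 0) :
    {v : Place K | Real.log (v.abv x) ≠ 0}.Finite := by
  have hfin : {v : FinitePlace K | v x ≠ 1}.Finite := FinitePlace.hasFiniteMulSupport hx
  refine ((Set.finite_range Sum.inl).union (hfin.image Sum.inr)).subset ?_
  rintro (v | v) hv
  · exact Or.inl ⟨v, rfl⟩
  · exact Or.inr ⟨v, fun h => hv (by rw [abv_finite_eq_one h, Real.log_one]), rfl⟩

theorem bddAbove_abs_log_abv {x : K} (hx : x ≠ 0) :
    BddAbove (Set.range fun v : Place K => |Real.log (v.abv x)|) := by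
  have hfin := (finite_log_abv_ne_zero hx).image fun v => |Real.log (v.abv x)|
  refine (hfin.insert 0).bddAbove.mono ?_
  rintro _ ⟨v, rfl⟩
  by_cases h : Real.log (v.abv x) = 0
  · exact Or.inl (abs_eq_zero.mpr h)
  · exact Or.inr ⟨v, h, rfl⟩

theorem heightIn_top (x : K) : heightIn ∞ x = ⨆ v : Place K, |Real.log (v.abv x)| := if_pos rfl

theorem heightIn_of_ne_top {p : ℝ≥0∞} (hp : p ≠ ∞) (x : K) :
    heightIn p x = (∑ᶠ v : Place K, (v.localDegree : ℝ) / (finrank ℚ K : ℝ) *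
      |Real.log (v.abv x)| ^ p.toReal) ^ (p.toReal)⁻¹ := if_neg hp

theorem heightIn_nonneg (p : ℝ≥0∞) (x : K) : 0 ≤ heightIn p x := by
  rcases eq_or_ne p ∞ with rfl | hp
  · rw [heightIn_top]
    exact Real.iSup_nonneg fun _ => abs_nonneg _
  · rw [heightIn_of_ne_top hp]
    exact Real.rpow_nonneg (finsum_nonneg fun _ => by positivity) _

theorem localDegree_div_mul_abs_log_le_heightIn {p : ℝ≥0∞} (hp1 : 1 ≤ p) {x : K} (hx : x ≠ 0)
    (v : Place K) :
    (v.localDegree : ℝ) / finrank ℚ K * |Real.log (v.abv x)| ≤ heightIn p x := by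
  set r : ℝ := (v.localDegree : ℝ) / finrank ℚ K
  have hr0 : 0 ≤ r := by positivity
  have hr1 : r ≤ 1 := div_le_one_of_le₀ (by exact_mod_cast localDegree_le_finrank v) (by positivity)
  rcases eq_or_ne p ∞ with rfl | hp
  · rw [heightIn_top]
    exact (mul_le_of_le_one_left (abs_nonneg _) hr1).trans (le_ciSup (bddAbove_abs_log_abv hx) v)
  have hq := one_le_toReal hp1 hp
  have hq0 : 0 < p.toReal := by linarith
  have hfin : (Function.support fun w : Place K => (w.localDegree : ℝ) / (finrank ℚ K : ℝ) *
      |Real.log (w.abv x)| ^ p.toReal).Finite := by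
    refine (finite_log_abv_ne_zero hx).subset fun w hw h => hw ?_
    simp only [h, abs_zero, Real.zero_rpow hq0.ne', mul_zero]
  rw [heightIn_of_ne_top hp, Real.le_rpow_inv_iff_of_pos (by positivity)
    (finsum_nonneg fun _ => by positivity) hq0]
  calc (r * |Real.log (v.abv x)|) ^ p.toReal
      = r ^ p.toReal * |Real.log (v.abv x)| ^ p.toReal := Real.mul_rpow hr0 (abs_nonneg _)
    _ ≤ r * |Real.log (v.abv x)| ^ p.toReal := by
        gcongr
        exact Real.rpow_le_self_of_le_one hr0 hr1 hq
    _ ≤ _ := single_le_finsum v hfin fun _ => by positivity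

theorem exists_log_finitePlace_eq (v : FinitePlace K) (x : K) :
    ∃ m : ℤ, Real.log (v x) = m * Real.log v.maximalIdeal.asIdeal.absNorm := by
  rw [← FinitePlace.norm_embedding_eq, FinitePlace.norm_embedding, HeightOneSpectrum.adicAbv_def]
  rcases eq_or_ne (v.maximalIdeal.valuation K x) 0 with h | h
  · exact ⟨0, by simp [h]⟩
  · exact ⟨_, by rw [WithZeroMulInt.toNNReal_neg_apply _ h, NNReal.coe_zpow, Real.log_zpow]; rfl⟩

theorem log_two_le_abs_log_finitePlace {v : FinitePlace K} {x : K} (h0 : x ≠ 0) (hv : v x ≠ 1) :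
    Real.log 2 ≤ |Real.log (v x)| := by
  obtain ⟨m, hm⟩ := exists_log_finitePlace_eq v x
  have hm0 : m ≠ 0 := by
    rintro rfl
    rw [Int.cast_zero, zero_mul] at hm
    exact hv (Real.eq_one_of_pos_of_log_eq_zero (FinitePlace.pos_iff.mpr h0) hm)
  have h1 : (1 : ℝ) ≤ |(m : ℝ)| := by exact_mod_cast Int.one_le_abs hm0
  have h2 : Real.log 2 ≤ Real.log v.maximalIdeal.asIdeal.absNorm :=
    Real.log_le_log two_pos (by exact_mod_cast HeightOneSpectrum.one_lt_absNorm v.maximalIdeal)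
  calc Real.log 2 ≤ Real.log v.maximalIdeal.asIdeal.absNorm := h2
    _ ≤ |Real.log v.maximalIdeal.asIdeal.absNorm| := le_abs_self _
    _ ≤ |(m : ℝ)| * |Real.log v.maximalIdeal.asIdeal.absNorm| :=
        le_mul_of_one_le_left (abs_nonneg _) h1
    _ = |Real.log (v x)| := by rw [hm, abs_mul]

end Places

section AlgUnits

/-- `x` is a nonzero algebraic unit: an element of a field that is integral over `ℤ` together with
its inverse. -/
structure IsAlgUnit {K : Type*} [Field K] (x : K) : Prop where
  ne_zero : x ≠ 0
  isIntegral : IsIntegral ℤ x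
  isIntegral_inv : IsIntegral ℤ x⁻¹

namespace IsAlgUnit

variable {K L : Type*} [Field K] [Field L]

theorem map_iff (f : K →+* L) {x : K} : IsAlgUnit (f x) ↔ IsAlgUnit x := by
  have hint (y : K) : IsIntegral ℤ (f y) ↔ IsIntegral ℤ y :=
    isIntegral_algHom_iff f.toIntAlgHom f.injective
  constructor <;> rintro ⟨h0, h1, h2⟩
  · exact ⟨(map_ne_zero f).mp h0, (hint _).mp h1, (hint _).mp (by rwa [map_inv₀])⟩
  · exact ⟨(map_ne_zero f).mpr h0, (hint _).mpr h1, by rw [← map_inv₀]; exact (hint _).mpr h2⟩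

theorem norm [Algebra K L] [FiniteDimensional K L] {x : L} (hx : IsAlgUnit x) :
    IsAlgUnit (Algebra.norm K x) where
  ne_zero := Algebra.norm_ne_zero_iff.mpr hx.ne_zero
  isIntegral := Algebra.isIntegral_norm K hx.isIntegral
  isIntegral_inv := by
    rw [← Algebra.norm_inv]
    exact Algebra.isIntegral_norm K hx.isIntegral_inv

theorem mul {x y : K} (hx : IsAlgUnit x) (hy : IsAlgUnit y) : IsAlgUnit (x * y) where
  ne_zero := mul_ne_zero hx.ne_zero hy.ne_zero
  isIntegral := hx.isIntegral.mul hy.isIntegral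
  isIntegral_inv := by
    rw [mul_inv]
    exact hx.isIntegral_inv.mul hy.isIntegral_inv

theorem of_isOfFinOrder {x : K} (hx : IsOfFinOrder x) : IsAlgUnit x := by
  obtain ⟨n, hn, hxn⟩ := isOfFinOrder_iff_pow_eq_one.mp hx
  exact ⟨hx.isUnit.ne_zero, .of_pow hn (hxn ▸ isIntegral_one),
    .of_pow hn (by rw [inv_pow, hxn, inv_one]; exact isIntegral_one)⟩

end IsAlgUnit

open NumberField

variable {K : Type*} [Field K] [NumberField K]

theorem isIntegral_iff_forall_finitePlace_le_one {x : K} :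
    IsIntegral ℤ x ↔ ∀ v : FinitePlace K, v x ≤ 1 := by
  refine ⟨fun hx v => ?_, fun h => ?_⟩
  · rw [← FinitePlace.norm_embedding_eq]
    exact FinitePlace.norm_le_one K v.maximalIdeal (⟨x, hx⟩ : 𝓞 K)
  · obtain ⟨y, rfl⟩ := IsDedekindDomain.HeightOneSpectrum.mem_integers_of_valuation_le_one
      (R := 𝓞 K) K x fun v => by
        have hv := h (FinitePlace.mk v)
        rw [FinitePlace.mk_apply, FinitePlace.norm_embedding, HeightOneSpectrum.adicAbv_def] at hv
        exact (WithZeroMulInt.toNNReal_le_one_iff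
          (HeightOneSpectrum.one_lt_absNorm_nnreal v)).mp (by exact_mod_cast hv)
    exact y.2

theorem isAlgUnit_iff_forall_finitePlace_eq_one {x : K} (h0 : x ≠ 0) :
    IsAlgUnit x ↔ ∀ v : FinitePlace K, v x = 1 := by
  have hinv (v : FinitePlace K) : v x⁻¹ ≤ 1 ↔ 1 ≤ v x := by
    rw [map_inv₀, inv_le_one₀ (FinitePlace.pos_iff.mpr h0)]
  refine ⟨fun hx v => le_antisymm (isIntegral_iff_forall_finitePlace_le_one.mp hx.isIntegral v)
    ((hinv v).mp (isIntegral_iff_forall_finitePlace_le_one.mp hx.isIntegral_inv v)), fun h => ⟨h0,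
    isIntegral_iff_forall_finitePlace_le_one.mpr fun v => (h v).le,
    isIntegral_iff_forall_finitePlace_le_one.mpr fun v => (hinv v).mpr (h v).ge⟩⟩

theorem log_two_le_finrank_mul_heightIn {p : ℝ≥0∞} (hp : 1 ≤ p) {x : K} (h0 : x ≠ 0)
    (hx : ¬ IsAlgUnit x) : Real.log 2 ≤ Module.finrank ℚ K * heightIn p x := by
  obtain ⟨v, hv⟩ := not_forall.mp (mt (isAlgUnit_iff_forall_finitePlace_eq_one h0).mpr hx)
  have hd : (0 : ℝ) < Module.finrank ℚ K := by exact_mod_cast Module.finrank_pos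
  calc Real.log 2 ≤ |Real.log (v x)| := log_two_le_abs_log_finitePlace h0 hv
    _ = Module.finrank ℚ K * ((Place.localDegree (Sum.inr v) : ℝ) / Module.finrank ℚ K *
          |Real.log (Place.abv (Sum.inr v) x)|) := by
        rw [← localDegree_mul_log_abv_finite v h0, abs_mul, Nat.abs_cast]
        field_simp
    _ ≤ Module.finrank ℚ K * heightIn p x := by
        gcongr
        exact localDegree_div_mul_abs_log_le_heightIn hp h0 _

theorem IsAlgUnit.log_abv_finite {x : K} (hx : IsAlgUnit x) (v : FinitePlace K) :
    Real.log (Place.abv (Sum.inr v) x) = 0 := by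
  rw [abv_finite_eq_one ((isAlgUnit_iff_forall_finitePlace_eq_one hx.ne_zero).mp hx v),
    Real.log_one]

theorem sum_mult_mul_eq_sum_embeddings (f : InfinitePlace K → ℝ) :
    ∑ v : InfinitePlace K, v.mult * f v = ∑ σ : K →+* ℂ, f (InfinitePlace.mk σ) := by
  classical
  rw [← Finset.sum_fiberwise' Finset.univ InfinitePlace.mk f]
  simp only [Finset.sum_const, InfinitePlace.card_filter_mk_eq, nsmul_eq_mul]

theorem IsAlgUnit.heightIn_eq_lpMean {x : K} (hx : IsAlgUnit x) {p : ℝ≥0∞} (hp : p ≠ 0) :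
    heightIn p x = lpMean p fun σ : K →+* ℂ => Real.log ‖σ x‖ := by
  rcases eq_or_ne p ∞ with rfl | hpt
  · rw [heightIn_top]
    refine le_antisymm ?_ ?_
    · have hnonneg : 0 ≤ lpMean ∞ fun σ : K →+* ℂ => Real.log ‖σ x‖ :=
        (abs_nonneg _).trans (abs_le_lpMean_top _ (Classical.arbitrary _))
      refine Real.iSup_le ?_ hnonneg
      rintro (v | v)
      · rw [Place.abv, ← InfinitePlace.norm_embedding_eq]
        exact abs_le_lpMean_top (fun σ : K →+* ℂ => Real.log ‖σ x‖) v.embedding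
      · rwa [hx.log_abv_finite, abs_zero]
    · rw [lpMean_top]
      exact ciSup_le fun σ => le_ciSup (bddAbove_abs_log_abv hx.ne_zero)
        (Sum.inl (InfinitePlace.mk σ))
  · have hq : p.toReal ≠ 0 := ENNReal.toReal_ne_zero.mpr ⟨hp, hpt⟩
    have hfin (v : FinitePlace K) : (Place.localDegree (Sum.inr v) : ℝ) / Module.finrank ℚ K *
        |Real.log (Place.abv (Sum.inr v) x)| ^ p.toReal = 0 := by
      rw [hx.log_abv_finite, abs_zero, Real.zero_rpow hq, mul_zero]
    rw [heightIn_of_ne_top hpt, lpMean_of_ne_top hpt, finsum_sum_eq_add (by simp [hfin])]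
    simp only [hfin, finsum_zero, add_zero]
    have hsum := sum_mult_mul_eq_sum_embeddings fun v : InfinitePlace K =>
      |Real.log (v x)| ^ p.toReal
    simp only [InfinitePlace.apply] at hsum
    rw [Embeddings.card, ← hsum, Finset.sum_div]
    simp only [Place.localDegree, Place.abv, div_mul_eq_mul_div]

end AlgUnits

section HeightInvariance

open NumberField Module

variable {K L : Type*} [Field K] [NumberField K] [Field L] [NumberField L] {p : ℝ≥0∞}

theorem heightIn_map (hp : p ≠ 0) (f : K →+* L) {x : K} (hx : IsAlgUnit x) :
    heightIn p (f x) = heightIn p x := by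
  classical
  let := f.toAlgebra
  have : FiniteDimensional K L := .of_restrictScalars_finite ℚ K L
  rw [((IsAlgUnit.map_iff f).mpr hx).heightIn_eq_lpMean hp, hx.heightIn_eq_lpMean hp]
  exact lpMean_comp (g := fun τ : L →+* ℂ => τ.comp (algebraMap K L)) finrank_pos.ne'
    card_extensions fun σ => Real.log ‖σ x‖

theorem heightIn_congr (hp : p ≠ 0) {x y : K} (hx : IsAlgUnit x) (hy : IsAlgUnit y)
    (h : ∀ σ : K →+* ℂ, ‖σ x‖ = ‖σ y‖) : heightIn p x = heightIn p y := by
  simp only [hx.heightIn_eq_lpMean hp, hy.heightIn_eq_lpMean hp, h]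

theorem heightIn_norm_le [Algebra K L] (hp : 1 ≤ p) {x : L} (hx : IsAlgUnit x) :
    heightIn p (Algebra.norm K x) ≤ finrank K L * heightIn p x := by
  classical
  have : FiniteDimensional K L := .of_restrictScalars_finite ℚ K L
  have hp0 : p ≠ 0 := (zero_lt_one.trans_le hp).ne'
  have hlog (σ : K →+* ℂ) : Real.log ‖σ (Algebra.norm K x)‖ =
      ∑ τ : L →+* ℂ with τ.comp (algebraMap K L) = σ, Real.log ‖τ x‖ := by
    rw [map_norm_eq_prod_extensions, norm_prod, Real.log_prod fun τ _ => by simpa using hx.ne_zero]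
  rw [hx.heightIn_eq_lpMean hp0, (hx.norm (K := K)).heightIn_eq_lpMean hp0]
  simp only [hlog]
  exact lpMean_sum_fiber_le hp finrank_pos.ne' card_extensions _

end HeightInvariance

section AlgebraicNumbers

open NumberField Module IntermediateField

variable {p : ℝ≥0∞}

theorem gen_ne_zero (α : Qbarˣ) : AdjoinSimple.gen ℚ (α : Qbar) ≠ 0 := fun h =>
  α.ne_zero (by simpa using congrArg (algebraMap ℚ⟮(α : Qbar)⟯ Qbar) h)

theorem isOfFinOrder_gen_iff {α : Qbarˣ} :
    IsOfFinOrder (AdjoinSimple.gen ℚ (α : Qbar)) ↔ α ∈ CommGroup.torsion Qbarˣ := by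
  rw [← isOfFinOrder_map_iff (algebraMap ℚ⟮(α : Qbar)⟯ Qbar), AdjoinSimple.algebraMap_gen,
    Units.isOfFinOrder_val]
  rfl

theorem isAlgUnit_gen_iff {α : Qbar} : IsAlgUnit (AdjoinSimple.gen ℚ α) ↔ IsAlgUnit α :=
  (IsAlgUnit.map_iff (algebraMap ℚ⟮α⟯ Qbar)).symm

theorem height_eq_heightIn (hp : p ≠ 0) {K : Type*} [Field K] [NumberField K] (f : K →ₐ[ℚ] Qbar)
    {x : K} (hx : IsAlgUnit x) {α : Qbarˣ} (hα : f x = α) : height p α = heightIn p x := by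
  have hle : ℚ⟮(α : Qbar)⟯ ≤ f.fieldRange := adjoin_simple_le_iff.mpr ⟨x, hα⟩
  let e : K ≃ₐ[ℚ] f.fieldRange := AlgEquiv.ofInjectiveField f
  let g : ℚ⟮(α : Qbar)⟯ →+* K := ((e.symm : f.fieldRange →ₐ[ℚ] K).comp (inclusion hle)).toRingHom
  have hg : g (AdjoinSimple.gen ℚ (α : Qbar)) = x :=
    e.symm_apply_eq.mpr (Subtype.ext hα.symm)
  rw [← hg] at hx ⊢
  exact (heightIn_map hp g ((IsAlgUnit.map_iff g).mp hx)).symm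

theorem height_eq_of_div_mem_torsion (hp : p ≠ 0) {α β : Qbarˣ} (hα : IsAlgUnit (α : Qbar))
    (hζ : α⁻¹ * β ∈ CommGroup.torsion Qbarˣ) : height p β = height p α := by
  obtain ⟨n, hn, hpow⟩ := isOfFinOrder_iff_pow_eq_one.mp hζ
  have hβ : IsAlgUnit (β : Qbar) := by
    have := hα.mul (.of_isOfFinOrder (Units.isOfFinOrder_val.mpr hζ))
    rwa [← Units.val_mul, mul_inv_cancel_left] at this
  let K : IntermediateField ℚ Qbar := ℚ⟮(α : Qbar)⟯ ⊔ ℚ⟮(β : Qbar)⟯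
  have : FiniteDimensional ℚ K := finiteDimensional_sup _ _
  have : NumberField K := ⟨⟩
  let x : K := ⟨α, (le_sup_left : _ ≤ K) (mem_adjoin_simple_self ℚ _)⟩
  let y : K := ⟨β, (le_sup_right : _ ≤ K) (mem_adjoin_simple_self ℚ _)⟩
  have hx : IsAlgUnit x := (IsAlgUnit.map_iff (algebraMap K Qbar)).mp hα
  have hy : IsAlgUnit y := (IsAlgUnit.map_iff (algebraMap K Qbar)).mp hβ
  have hxy : y ^ n = x ^ n := Subtype.ext <| by
    have h : β ^ n = α ^ n := by rwa [mul_pow, inv_pow, inv_mul_eq_one, eq_comm] at hpow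
    simpa using congrArg Units.val h
  rw [height_eq_heightIn hp K.val hx rfl, height_eq_heightIn hp K.val hy rfl]
  refine heightIn_congr hp hy hx fun σ => ?_
  rw [← pow_left_inj₀ (norm_nonneg _) (norm_nonneg _) hn.ne', ← norm_pow, ← norm_pow, ← map_pow,
    ← map_pow, hxy]

theorem clsHeight_cls (hp : p ≠ 0) {α : Qbarˣ} (hα : IsAlgUnit (α : Qbar)) :
    clsHeight p (cls α) = height p α :=
  height_eq_of_div_mem_torsion hp hα <| QuotientGroup.eq.mp <| Eq.symm <|
    Quotient.out_eq (Additive.toMul (cls α))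

theorem minMahler_cls_le (hp : p ≠ 0) {α : Qbarˣ} (hα : IsAlgUnit (α : Qbar)) :
    minMahler p (cls α) ≤ mahler p α := by
  rw [minMahler, mahler, clsHeight_cls hp hα]
  refine mul_le_mul_of_nonneg_right ?_ (heightIn_nonneg _ _)
  exact Nat.cast_le.mpr (Nat.sInf_le ⟨α, rfl, rfl⟩)

theorem minMahler_nonneg (p : ℝ≥0∞) (a : AlgModTors) : 0 ≤ minMahler p a :=
  mul_nonneg (Nat.cast_nonneg _) (heightIn_nonneg _ _)

theorem normHeight_le {f : AlgModTors → ℝ} (hf : ∀ a, 0 ≤ f a) (a : AlgModTors) :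
    normHeight f a ≤ f a := by
  refine csInf_le ⟨0, ?_⟩ ⟨1, fun _ => 1, fun _ => a, by simp, by simp⟩
  rintro _ ⟨n, r, b, -, rfl⟩
  exact Finset.sum_nonneg fun i _ => mul_nonneg (abs_nonneg _) (hf _)

theorem cls_eq_zero_iff {α : Qbarˣ} : cls α = 0 ↔ IsOfFinOrder (α : Qbar) := by
  rw [Units.isOfFinOrder_val]
  exact QuotientGroup.eq_one_iff α

section NormDescent

variable {F K : Type*} [Field F] [NumberField F] [Field K] [NumberField K] {b : F}

theorem deg_map (f : F →ₐ[ℚ] Qbar) (hb : ℚ⟮b⟯ = ⊤) : deg (f b) = finrank ℚ F := by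
  obtain ⟨e, -⟩ := exists_algEquiv_adjoin_map hb f
  exact e.toLinearEquiv.finrank_eq.symm

theorem cls_mem_setA (hb : IsAlgUnit b) (hirr : IsNormIrreducible ℚ b) (htor : ¬ IsOfFinOrder b)
    (f : F →ₐ[ℚ] Qbar) (h0 : f b ≠ 0) : cls (Units.mk0 (f b) h0) ∈ setA := by
  have hadj {n : ℕ} (hn : n ≠ 0) : ℚ⟮b ^ n⟯ = ⊤ := hirr.adjoin_pow_eq_top htor hn
  have hadj1 : ℚ⟮b⟯ = ⊤ := by simpa only [pow_one] using hadj one_ne_zero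
  have hfb : IsAlgUnit (f b) := (IsAlgUnit.map_iff f.toRingHom).mpr hb
  refine ⟨?_, Units.mk0 (f b) h0, rfl, ⟨hfb.isIntegral, ?_⟩, fun n hn => ?_, ?_⟩
  · exact cls_eq_zero_iff.not.mpr (mt (isOfFinOrder_map_iff f.toRingHom).mp htor)
  · rw [Units.val_inv_eq_inv_val]
    exact hfb.isIntegral_inv
  · rw [Units.val_mk0, ← map_pow, deg_map f (hadj (by omega)), deg_map f hadj1]
  · obtain ⟨e, he⟩ := exists_algEquiv_adjoin_map hadj1 f
    exact he ▸ hirr.map_algEquiv e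

theorem mahler_norm_le [Algebra F K] (hp : 1 ≤ p) {x : K} (hx : IsAlgUnit x)
    (hadj : ℚ⟮Algebra.norm F x⟯ = ⊤) (f : F →ₐ[ℚ] Qbar) (h0 : f (Algebra.norm F x) ≠ 0) :
    mahler p (Units.mk0 (f (Algebra.norm F x)) h0) ≤ finrank ℚ K * heightIn p x := by
  have : FiniteDimensional F K := .of_restrictScalars_finite ℚ F K
  calc mahler p (Units.mk0 (f (Algebra.norm F x)) h0)
      = finrank ℚ F * heightIn p (Algebra.norm F x) := by
        rw [mahler, height_eq_heightIn (zero_lt_one.trans_le hp).ne' f hx.norm rfl,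
          Units.val_mk0, deg_map f hadj]
    _ ≤ finrank ℚ F * (finrank F K * heightIn p x) := by
        gcongr
        exact heightIn_norm_le hp hx
    _ = finrank ℚ K * heightIn p x := by
        rw [← mul_assoc, ← Nat.cast_mul, finrank_mul_finrank]

end NormDescent

theorem exists_mem_setA_minMahler_le (hp : 1 ≤ p) {α : Qbarˣ} (hα : IsAlgUnit (α : Qbar))
    (htor : α ∉ CommGroup.torsion Qbarˣ) : ∃ a ∈ setA, minMahler p a ≤ mahler p α := by
  set x := AdjoinSimple.gen ℚ (α : Qbar)
  have hx : IsAlgUnit x := isAlgUnit_gen_iff.mpr hα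
  obtain ⟨F, hF, hirr⟩ := exists_isNormIrreducible_norm (k := ℚ) (mt isOfFinOrder_gen_iff.mp htor)
  have hb : IsAlgUnit (Algebra.norm F x) := hx.norm
  have hadj := hirr.adjoin_pow_eq_top hF one_ne_zero
  rw [pow_one] at hadj
  let f : F →ₐ[ℚ] Qbar := (val ℚ⟮(α : Qbar)⟯).comp F.val
  have hβ : IsAlgUnit (f (Algebra.norm F x)) := (IsAlgUnit.map_iff f.toRingHom).mpr hb
  exact ⟨cls (Units.mk0 _ hβ.ne_zero), cls_mem_setA hb hirr hF f hβ.ne_zero,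
    (minMahler_cls_le (zero_lt_one.trans_le hp).ne' hβ).trans
      (mahler_norm_le hp hx hadj f hβ.ne_zero)⟩

theorem log_two_le_mahler (hp : 1 ≤ p) {α : Qbarˣ} (hα : ¬ IsAlgUnit (α : Qbar)) :
    Real.log 2 ≤ mahler p α :=
  log_two_le_finrank_mul_heightIn hp (gen_ne_zero α) (mt isAlgUnit_gen_iff.mp hα)

/-- `m_p` is bounded away from zero on `𝒜`. As the extremal norm is at most `m_p`, this is a weaker
condition than `ExtremalBound p`. -/
def MinMahlerBound (p : ℝ≥0∞) : Prop :=
  ∃ c : ℝ, 0 < c ∧ ∀ a ∈ setA, c ≤ minMahler p a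

theorem ExtremalBound.minMahlerBound (h : ExtremalBound p) : MinMahlerBound p := by
  obtain ⟨c, hc, hA⟩ := h
  exact ⟨c, hc, fun a ha => (hA a ha).trans (normHeight_le (minMahler_nonneg p) a)⟩

theorem MinMahlerBound.lpLehmerBound (hp : 1 ≤ p) (h : MinMahlerBound p) : LpLehmerBound p := by
  obtain ⟨c, hc, hA⟩ := h
  refine ⟨min c (Real.log 2), lt_min hc (Real.log_pos one_lt_two), fun α htor => ?_⟩
  by_cases hα : IsAlgUnit (α : Qbar)
  · obtain ⟨a, ha, hle⟩ := exists_mem_setA_minMahler_le hp hα htor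
    exact (min_le_left _ _).trans ((hA a ha).trans hle)
  · exact (min_le_right _ _).trans (log_two_le_mahler hp hα)

end AlgebraicNumbers

section ProductFormula

open NumberField Module IntermediateField

variable {K : Type*} [Field K] [NumberField K]

theorem finsum_localDegree_mul_log {x : K} (hx : x ≠ 0) :
    ∑ᶠ v : Place K, (v.localDegree : ℝ) / (finrank ℚ K : ℝ) * Real.log (v.abv x) = 0 := by
  have hinf (v : InfinitePlace K) : v x ^ v.mult ≠ 0 := pow_ne_zero _ ((map_ne_zero v).mpr hx)
  have hfin (v : FinitePlace K) : 0 < v x := FinitePlace.pos_iff.mpr hx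
  have hfinprod : 0 < ∏ᶠ v : FinitePlace K, v x :=
    finprod_induction (0 < ·) one_pos (fun _ _ => mul_pos) hfin
  have hlog : ∑ v : InfinitePlace K, v.mult * Real.log (v x) +
      ∑ᶠ v : FinitePlace K, Real.log (v x) = 0 := by
    simp only [← Real.log_pow]
    rw [← Real.log_finprod hfin, ← Real.log_prod fun v _ => hinf v,
      ← Real.log_mul (Finset.prod_ne_zero_iff.mpr fun v _ => hinf v) hfinprod.ne',
      prod_abs_eq_one hx, Real.log_one]
  have hsupp : (Function.support fun v : FinitePlace K => Real.log (v x)).Finite :=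
    (FinitePlace.hasFiniteMulSupport hx).subset fun v hv h => hv (by simp only [h, Real.log_one])
  simp only [div_mul_eq_mul_div]
  simp only [div_eq_mul_inv]
  rw [← finsum_mul, finsum_sum_eq_add] <;> simp only [localDegree_mul_log_abv_finite _ hx]
  · rw [← zero_mul, ← hlog]
    rfl
  · exact hsupp

theorem heightIn_one {x : K} (hx : x ≠ 0) : heightIn 1 x = 2 * weilHeightIn x := by
  have hsupp (g : ℝ → ℝ) (hg : g 0 = 0) : (Function.support fun v : Place K =>
      (v.localDegree : ℝ) / (finrank ℚ K : ℝ) * g (Real.log (v.abv x))).Finite :=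
    (finite_log_abv_ne_zero hx).subset fun v hv h => hv (by simp only [h, hg, mul_zero])
  have habs (t : ℝ) : |t| = 2 * max 0 t - t := by
    rcases le_total 0 t with h | h
    · rw [abs_of_nonneg h, max_eq_right h]; ring
    · rw [abs_of_nonpos h, max_eq_left h]; ring
  calc heightIn 1 x = ∑ᶠ v : Place K, (v.localDegree : ℝ) / (finrank ℚ K : ℝ) *
          |Real.log (v.abv x)| := by
        simp only [heightIn_of_ne_top ENNReal.one_ne_top, ENNReal.toReal_one, inv_one,
          Real.rpow_one]
    _ = ∑ᶠ v : Place K, ((v.localDegree : ℝ) / (finrank ℚ K : ℝ) *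
            (2 * max 0 (Real.log (v.abv x))) -
          (v.localDegree : ℝ) / (finrank ℚ K : ℝ) * Real.log (v.abv x)) :=
        finsum_congr fun v => by rw [habs, mul_sub]
    _ = ∑ᶠ v : Place K, (v.localDegree : ℝ) / (finrank ℚ K : ℝ) *
          (2 * max 0 (Real.log (v.abv x))) := by
        rw [finsum_sub_distrib (hsupp (fun t => 2 * max 0 t) (by simp)) (hsupp (fun t => t) rfl),
          finsum_localDegree_mul_log hx, sub_zero]
    _ = 2 * weilHeightIn x := by
        rw [weilHeightIn, mul_finsum]
        exact finsum_congr fun v => mul_left_comm _ _ _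

theorem LpLehmerBound.lehmerConjecture (h : LpLehmerBound 1) : LehmerConjecture := by
  obtain ⟨c, hc, hbound⟩ := h
  refine ⟨c / 2, half_pos hc, fun α hα => ?_⟩
  have hα := hbound α hα
  rw [mahler, height, heightIn_one (gen_ne_zero α)] at hα
  rw [weilHeight]
  linarith

end ProductFormula

section HardySpace

open PowerSeries ComplexConjugate

/-- The squared norm, in the Hardy space `H²` of the unit disc, of the truncation of a power series
to degree at most `n`. -/
def truncNormSq (n : ℕ) (w : ℂ⟦X⟧) : ℝ := ∑ i ∈ Finset.range (n + 1), ‖coeff i w‖ ^ 2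

theorem truncNormSq_one (n : ℕ) : truncNormSq n 1 = 1 := by
  rw [truncNormSq, Finset.sum_range_succ']
  simp [coeff_one]

theorem norm_sq_add_norm_sq_le_truncNormSq {n : ℕ} (hn : n ≠ 0) (w : ℂ⟦X⟧) :
    ‖constantCoeff w‖ ^ 2 + ‖coeff n w‖ ^ 2 ≤ truncNormSq n w := by
  rw [← coeff_zero_eq_constantCoeff_apply, truncNormSq,
    ← Finset.sum_pair (f := fun i => ‖coeff i w‖ ^ 2) hn.symm]
  exact Finset.sum_le_sum_of_subset_of_nonneg (by grind) fun _ _ _ => by positivity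

theorem norm_sub_conj_mul_sq_sub_norm_sub_mul_sq (a z t : ℂ) :
    ‖z - conj a * t‖ ^ 2 - ‖t - a * z‖ ^ 2 = (1 - ‖a‖ ^ 2) * (‖z‖ ^ 2 - ‖t‖ ^ 2) := by
  simp only [← Complex.normSq_eq_norm_sq, Complex.normSq_apply, Complex.sub_re, Complex.sub_im,
    Complex.mul_re, Complex.mul_im, Complex.conj_re, Complex.conj_im]
  ring

theorem truncNormSq_sub_truncNormSq (n : ℕ) (a : ℂ) (w : ℂ⟦X⟧) :
    truncNormSq n ((1 - C (conj a) * X) * w) - truncNormSq n ((X - C a) * w) =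
      (1 - ‖a‖ ^ 2) * ‖coeff n w‖ ^ 2 := by
  induction n with
  | zero =>
    simp only [truncNormSq, zero_add, Finset.range_one, Finset.sum_singleton, sub_mul, one_mul,
      map_sub, mul_assoc, coeff_C_mul, coeff_zero_X_mul, mul_zero, sub_zero, zero_sub, norm_neg,
      norm_mul]
    ring
  | succ n ih =>
    have hden : coeff (n + 1) ((1 - C (conj a) * X) * w) =
        coeff (n + 1) w - conj a * coeff n w := by
      simp only [sub_mul, one_mul, map_sub, mul_assoc, coeff_C_mul, coeff_succ_X_mul]
    have hnum : coeff (n + 1) ((X - C a) * w) = coeff n w - a * coeff (n + 1) w := by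
      simp only [sub_mul, map_sub, coeff_C_mul, coeff_succ_X_mul]
    have hsq := norm_sub_conj_mul_sq_sub_norm_sub_mul_sq a (coeff (n + 1) w) (coeff n w)
    simp only [truncNormSq] at ih ⊢
    rw [Finset.sum_range_succ _ (n + 1), Finset.sum_range_succ _ (n + 1), hden, hnum]
    linarith

theorem truncNormSq_prod_mul_le {ι : Type*} (n : ℕ) {s : Multiset ι} {u v : ι → ℂ⟦X⟧}
    (h : ∀ i ∈ s, ∀ w, truncNormSq n (u i * w) ≤ truncNormSq n (v i * w)) (w : ℂ⟦X⟧) :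
    truncNormSq n ((s.map u).prod * w) ≤ truncNormSq n ((s.map v).prod * w) := by
  induction s using Multiset.induction_on generalizing w with
  | empty => simp only [Multiset.map_zero, Multiset.prod_zero, le_refl]
  | cons i s ih =>
    rw [Multiset.forall_mem_cons] at h
    simp only [Multiset.map_cons, Multiset.prod_cons]
    calc truncNormSq n (u i * (s.map u).prod * w)
        ≤ truncNormSq n (v i * ((s.map u).prod * w)) := mul_assoc (u i) _ w ▸ h.1 _
      _ = truncNormSq n ((s.map u).prod * (v i * w)) := by rw [mul_left_comm]
      _ ≤ truncNormSq n ((s.map v).prod * (v i * w)) := ih h.2 _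
      _ = truncNormSq n (v i * (s.map v).prod * w) := by rw [mul_left_comm, mul_assoc]

/-- The numerator `∏ (X - z)` of the Blaschke product with zeros `s`. -/
def blaschkeNum (s : Multiset ℂ) : ℂ⟦X⟧ := (s.map fun z => X - C z).prod

/-- The denominator `∏ (1 - z̄ X)` of the Blaschke product with zeros `s`. -/
def blaschkeDen (s : Multiset ℂ) : ℂ⟦X⟧ := (s.map fun z => 1 - C (conj z) * X).prod

theorem blaschkeNum_add (s t : Multiset ℂ) :
    blaschkeNum (s + t) = blaschkeNum s * blaschkeNum t := by
  rw [blaschkeNum, Multiset.map_add, Multiset.prod_add]; rfl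

theorem blaschkeDen_add (s t : Multiset ℂ) :
    blaschkeDen (s + t) = blaschkeDen s * blaschkeDen t := by
  rw [blaschkeDen, Multiset.map_add, Multiset.prod_add]; rfl

theorem norm_constantCoeff_blaschkeNum (s : Multiset ℂ) :
    ‖constantCoeff (blaschkeNum s)‖ = (s.map norm).prod := by
  rw [blaschkeNum, map_multiset_prod, ← normHom_apply, map_multiset_prod, Multiset.map_map,
    Multiset.map_map]
  simp

theorem constantCoeff_blaschkeDen (s : Multiset ℂ) : constantCoeff (blaschkeDen s) = 1 := by
  rw [blaschkeDen, map_multiset_prod, Multiset.map_map]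
  simp

theorem constantCoeff_blaschkeDen_ne_zero (s : Multiset ℂ) :
    constantCoeff (blaschkeDen s) ≠ 0 :=
  (constantCoeff_blaschkeDen s).trans_ne one_ne_zero

theorem constantCoeff_blaschkeNum_ne_zero {s : Multiset ℂ} (hs : ∀ z ∈ s, 1 ≤ ‖z‖) :
    constantCoeff (blaschkeNum s) ≠ 0 := by
  rw [← norm_ne_zero_iff, norm_constantCoeff_blaschkeNum]
  refine Multiset.prod_ne_zero fun h => ?_
  obtain ⟨z, hz, h0⟩ := Multiset.mem_map.mp h
  exact (zero_lt_one.trans_le (hs z hz)).ne' h0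

theorem truncNormSq_blaschke_le_one (n : ℕ) {s : Multiset ℂ} (hs : ∀ z ∈ s, ‖z‖ ≤ 1) :
    truncNormSq n (blaschkeNum s * (blaschkeDen s)⁻¹) ≤ 1 := by
  rw [← truncNormSq_one n,
    ← PowerSeries.mul_inv_cancel _ (constantCoeff_blaschkeDen_ne_zero s)]
  refine truncNormSq_prod_mul_le n (fun z hz w => sub_nonneg.mp ?_) _
  rw [truncNormSq_sub_truncNormSq]
  exact mul_nonneg (sub_nonneg.mpr (pow_le_one₀ (norm_nonneg z) (hs z hz))) (sq_nonneg _)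

theorem truncNormSq_inv_blaschke_le_one (n : ℕ) {s : Multiset ℂ} (hs : ∀ z ∈ s, 1 ≤ ‖z‖) :
    truncNormSq n (blaschkeDen s * (blaschkeNum s)⁻¹) ≤ 1 := by
  rw [← truncNormSq_one n,
    ← PowerSeries.mul_inv_cancel _ (constantCoeff_blaschkeNum_ne_zero hs)]
  refine truncNormSq_prod_mul_le n (fun z hz w => sub_nonpos.mp ?_) _
  rw [truncNormSq_sub_truncNormSq]
  exact mul_nonpos_of_nonpos_of_nonneg (sub_nonpos.mpr (one_le_pow₀ (hs z hz))) (sq_nonneg _)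

theorem exists_eq_C_add_X_pow_mul {R : Type*} [CommRing R] {A : R⟦X⟧}
    (hA : A ≠ C (constantCoeff A)) :
    ∃ k ≠ 0, ∃ B : R⟦X⟧, constantCoeff B ≠ 0 ∧ A = C (constantCoeff A) + X ^ k * B := by
  have hcoeff := coeff_order (sub_ne_zero.mpr hA)
  obtain ⟨B, hB⟩ := X_pow_order_dvd (φ := A - C (constantCoeff A))
  set k := (A - C (constantCoeff A)).order.toNat
  refine ⟨k, fun hk => hcoeff ?_, B, fun hB0 => hcoeff ?_, ?_⟩
  · rw [hk, coeff_zero_eq_constantCoeff_apply, map_sub, constantCoeff_C, sub_self]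
  · rw [hB, coeff_X_pow_mul', if_pos le_rfl, Nat.sub_self, coeff_zero_eq_constantCoeff_apply, hB0]
  · rw [← hB, add_sub_cancel]

theorem five_mul_norm_constantCoeff_sq_le {A : ℤ⟦X⟧} (hA0 : |constantCoeff A| = 1)
    (hA : A ≠ C (constantCoeff A)) {g : ℂ⟦X⟧} (hg : ∀ n, truncNormSq n g ≤ 1)
    (hAg : ∀ n, truncNormSq n (A.map (Int.castRingHom ℂ) * g) ≤ 1) :
    5 * ‖constantCoeff g‖ ^ 2 ≤ 4 := by
  obtain ⟨k, hk, B, hB, hAB⟩ := exists_eq_C_add_X_pow_mul hA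
  set ε := constantCoeff A
  set f := A.map (Int.castRingHom ℂ) * g with hf
  have hε : ‖(ε : ℂ)‖ = 1 := by rw [Complex.norm_intCast, ← Int.cast_abs, hA0, Int.cast_one]
  have hf' : f = C (ε : ℂ) * g + X ^ k * (B.map (Int.castRingHom ℂ) * g) := by
    rw [hf, hAB, map_add, map_mul, map_pow, map_C, map_X, eq_intCast (Int.castRingHom ℂ)]
    ring
  have hf0 : ‖constantCoeff f‖ = ‖constantCoeff g‖ := by
    rw [hf', map_add, map_mul, map_mul, constantCoeff_C, map_pow, constantCoeff_X, zero_pow hk,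
      zero_mul, add_zero, norm_mul, hε, one_mul]
  have hfk : coeff k f = ε * coeff k g + (constantCoeff B : ℤ) * constantCoeff g := by
    rw [hf', map_add, coeff_C_mul, coeff_X_pow_mul', if_pos le_rfl, Nat.sub_self,
      coeff_zero_eq_constantCoeff_apply, map_mul,
      ← coeff_zero_eq_constantCoeff_apply (map _ B), coeff_map, eq_intCast,
      coeff_zero_eq_constantCoeff_apply]
  have hB1 : 1 ≤ ‖((constantCoeff B : ℤ) : ℂ)‖ := by
    rw [Complex.norm_intCast]
    exact_mod_cast Int.one_le_abs hB
  have hle : ‖constantCoeff g‖ ≤ ‖coeff k f‖ + ‖coeff k g‖ :=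
    calc ‖constantCoeff g‖ ≤ ‖((constantCoeff B : ℤ) : ℂ)‖ * ‖constantCoeff g‖ :=
          le_mul_of_one_le_left (norm_nonneg _) hB1
      _ = ‖coeff k f - ε * coeff k g‖ := by rw [hfk, add_sub_cancel_left, norm_mul]
      _ ≤ ‖coeff k f‖ + ‖ε * coeff k g‖ := norm_sub_le _ _
      _ = ‖coeff k f‖ + ‖coeff k g‖ := by rw [norm_mul, hε, one_mul]
  have hf1 := (norm_sq_add_norm_sq_le_truncNormSq hk f).trans (hAg k)
  have hg1 := (norm_sq_add_norm_sq_le_truncNormSq hk g).trans (hg k)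
  rw [hf0] at hf1
  nlinarith [sq_nonneg (‖coeff k f‖ - ‖coeff k g‖), norm_nonneg (constantCoeff g)]

end HardySpace

section Smyth

open Polynomial ComplexConjugate

theorem reverse_prod_X_sub_C {R : Type*} [CommRing R] [IsDomain R] (s : Multiset R) :
    (s.map fun z => X - C z).prod.reverse = (s.map fun z => 1 - C z * X).prod := by
  induction s using Multiset.induction_on with
  | empty => simpa using reverse_C (1 : R)
  | cons a s ih =>
    have ha : (X - C a).reverse = 1 - C a * X := by
      rw [sub_eq_add_neg, ← C_neg, ← one_mul X, reverse_add_C, reverse_mul_X, one_mul, natDegree_X,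
        pow_one, C_neg, neg_mul, ← sub_eq_add_neg, ← C_1, reverse_C]
    simp only [Multiset.map_cons, Multiset.prod_cons, reverse_mul_of_domain, ih, ha]

theorem reverse_map_of_injective {R S : Type*} [Semiring R] [Semiring S] {φ : R →+* S}
    (hφ : Function.Injective φ) (P : R[X]) : (P.map φ).reverse = P.reverse.map φ := by
  rw [reverse, reverse, natDegree_map_eq_of_injective hφ, reflect_map]

theorem coe_eq_blaschkeNum_roots {P : ℂ[X]} (hP : P.Monic) :
    (P : PowerSeries ℂ) = blaschkeNum P.roots := by
  conv_lhs => rw [(IsAlgClosed.splits P).eq_prod_roots_of_monic hP]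
  rw [← coeToPowerSeries.ringHom_apply, map_multiset_prod, Multiset.map_map]
  simp [blaschkeNum, Function.comp_def]

theorem coe_reverse_map_conj_eq_blaschkeDen_roots {P : ℂ[X]} (hP : P.Monic) :
    ((P.map conj).reverse : PowerSeries ℂ) = blaschkeDen P.roots := by
  conv_lhs => rw [(IsAlgClosed.splits P).eq_prod_roots_of_monic hP]
  rw [reverse_map_of_injective (RingHom.injective _), reverse_prod_X_sub_C,
    ← coeToPowerSeries.ringHom_apply, Polynomial.map_multiset_prod, map_multiset_prod,
    Multiset.map_map, Multiset.map_map]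
  simp [blaschkeDen]

theorem coe_map_reverse_eq_blaschkeDen_roots {P : ℤ[X]} (hP : P.Monic) :
    (P.reverse.map (Int.castRingHom ℂ) : PowerSeries ℂ) =
      blaschkeDen (P.map (Int.castRingHom ℂ)).roots := by
  rw [← coe_reverse_map_conj_eq_blaschkeDen_roots (hP.map _), Polynomial.map_map,
    RingHom.eq_intCast' ((conj : ℂ →+* ℂ).comp (Int.castRingHom ℂ)),
    reverse_map_of_injective (RingHom.injective_int _)]

theorem mahlerMeasure_eq_norm_constantCoeff_blaschkeNum {P : ℂ[X]} (hP : P.Monic) :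
    P.mahlerMeasure =
      ‖PowerSeries.constantCoeff (blaschkeNum (P.roots.filter fun z => ¬ ‖z‖ ≤ 1))‖ := by
  rw [mahlerMeasure_eq_leadingCoeff_mul_prod_roots, hP.leadingCoeff, norm_one, one_mul,
    norm_constantCoeff_blaschkeNum]
  conv_lhs => rw [← Multiset.filter_add_not (fun z => ‖z‖ ≤ 1) P.roots]
  rw [Multiset.map_add, Multiset.prod_add,
    Multiset.map_congr rfl fun z hz => max_eq_left (Multiset.mem_filter.mp hz).2,
    Multiset.map_congr (g := norm) rfl fun z hz =>
      max_eq_right (not_le.mp (Multiset.mem_filter.mp hz).2).le,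
    Multiset.map_const', Multiset.prod_replicate, one_pow, one_mul]

theorem exists_powerSeries_mul_reverse_eq {P : ℤ[X]} (hP : P.Monic) :
    ∃ A : PowerSeries ℤ, A * P.reverse = P := by
  have hrev : PowerSeries.constantCoeff (P.reverse : PowerSeries ℤ) = ((1 : ℤˣ) : ℤ) := by
    simp [hP.leadingCoeff]
  exact ⟨(P : PowerSeries ℤ) * PowerSeries.invOfUnit (P.reverse : PowerSeries ℤ) 1, by
    rw [mul_assoc, PowerSeries.invOfUnit_mul _ _ hrev, mul_one]⟩

/-- A weak form of a theorem of Smyth. -/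
theorem five_le_four_mul_mahlerMeasure_sq {P : ℤ[X]} (hP : P.Monic) (h0 : |P.coeff 0| = 1)
    (hrec : P ≠ C (P.coeff 0) * P.reverse) :
    5 ≤ 4 * (P.map (Int.castRingHom ℂ)).mahlerMeasure ^ 2 := by
  have hPm := hP.map (Int.castRingHom ℂ)
  obtain ⟨A, hA⟩ := exists_powerSeries_mul_reverse_eq hP
  have hA0 : PowerSeries.constantCoeff A = P.coeff 0 := by
    simpa [hP.leadingCoeff] using congrArg PowerSeries.constantCoeff hA
  have hA1 : A ≠ PowerSeries.C (PowerSeries.constantCoeff A) := fun h =>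
    hrec <| Polynomial.coe_injective ℤ <| by rw [coe_mul, coe_C, ← hA0, ← h, hA]
  have hAmap := congrArg (PowerSeries.map (Int.castRingHom ℂ)) hA
  rw [map_mul, ← polynomial_map_coe, ← polynomial_map_coe, coe_eq_blaschkeNum_roots hPm,
    coe_map_reverse_eq_blaschkeDen_roots hP] at hAmap
  rw [mahlerMeasure_eq_norm_constantCoeff_blaschkeNum hPm]
  set s := (P.map (Int.castRingHom ℂ)).roots
  set sI := s.filter fun z => ‖z‖ ≤ 1
  set sO := s.filter fun z => ¬ ‖z‖ ≤ 1
  have hI : ∀ z ∈ sI, ‖z‖ ≤ 1 := fun z hz => (Multiset.mem_filter.mp hz).2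
  have hO : ∀ z ∈ sO, 1 ≤ ‖z‖ := fun z hz => (not_le.mp (Multiset.mem_filter.mp hz).2).le
  rw [← Multiset.filter_add_not (fun z => ‖z‖ ≤ 1) s, blaschkeNum_add, blaschkeDen_add] at hAmap
  have hnum := constantCoeff_blaschkeNum_ne_zero hO
  have hAg : A.map (Int.castRingHom ℂ) * (blaschkeDen sO * (blaschkeNum sO)⁻¹) =
      blaschkeNum sI * (blaschkeDen sI)⁻¹ := by
    rw [PowerSeries.eq_mul_inv_iff_mul_eq (constantCoeff_blaschkeDen_ne_zero sI)]
    calc A.map (Int.castRingHom ℂ) * (blaschkeDen sO * (blaschkeNum sO)⁻¹) * blaschkeDen sI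
        = A.map (Int.castRingHom ℂ) * (blaschkeDen sI * blaschkeDen sO) * (blaschkeNum sO)⁻¹ := by
          ring
      _ = blaschkeNum sI * (blaschkeNum sO * (blaschkeNum sO)⁻¹) := by rw [hAmap, mul_assoc]
      _ = blaschkeNum sI := by rw [PowerSeries.mul_inv_cancel _ hnum, mul_one]
  have key := five_mul_norm_constantCoeff_sq_le (hA0 ▸ h0) hA1
    (fun n => truncNormSq_inv_blaschke_le_one n hO)
    (fun n => hAg ▸ truncNormSq_blaschke_le_one n hI)
  rwa [map_mul, constantCoeff_blaschkeDen, one_mul, PowerSeries.constantCoeff_inv, norm_inv,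
    inv_pow, mul_inv_le_iff₀ (by positivity)] at key

end Smyth

section House

open NumberField Module IntermediateField

variable {K : Type*} [Field K] [NumberField K] {x : K}

theorem abs_norm_le_house_pow (x : K) :
    |(Algebra.norm ℚ x : ℝ)| ≤ NumberField.house x ^ finrank ℚ K := by
  obtain ⟨σ⟩ : Nonempty (K →+* ℂ) := inferInstance
  calc |(Algebra.norm ℚ x : ℝ)| = ‖Algebra.norm ℚ x‖ := by
        rw [← Rat.norm_cast_real, Real.norm_eq_abs]
    _ ≤ ‖σ x‖ * NumberField.house x ^ (finrank ℚ K - 1) := norm_norm_le_norm_mul_house_pow x σ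
    _ ≤ NumberField.house x * NumberField.house x ^ (finrank ℚ K - 1) :=
        mul_le_mul_of_nonneg_right (norm_embedding_le_house x σ) (pow_nonneg (house_nonneg x) _)
    _ = NumberField.house x ^ finrank ℚ K := by
        rw [← pow_succ', Nat.sub_add_cancel finrank_pos]

theorem abs_norm_eq_one_iff (hx : IsIntegral ℤ x) : |Algebra.norm ℚ x| = 1 ↔ IsAlgUnit x := by
  let y : 𝓞 K := ⟨x, hx⟩
  have hnorm : (RingOfIntegers.norm ℚ y : ℚ) = Algebra.norm ℚ x := RingOfIntegers.coe_norm ℚ y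
  rw [← hnorm, ← isUnit_iff_norm, isUnit_iff_exists_inv]
  constructor
  · rintro ⟨z, hz⟩
    have hxz : x * (z : K) = 1 := congrArg (algebraMap (𝓞 K) K) hz
    exact ⟨left_ne_zero_of_mul_eq_one hxz, hx, inv_eq_of_mul_eq_one_right hxz ▸ z.2⟩
  · exact fun hu => ⟨⟨x⁻¹, hu.isIntegral_inv⟩, RingOfIntegers.ext (mul_inv_cancel₀ hu.ne_zero)⟩

theorem two_le_house_pow_finrank (hx : IsIntegral ℤ x) (h0 : x ≠ 0) (hu : ¬ IsAlgUnit x) :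
    2 ≤ NumberField.house x ^ finrank ℚ K := by
  obtain ⟨n, hn⟩ := IsIntegrallyClosed.isIntegral_iff.mp (Algebra.isIntegral_norm ℚ hx)
  replace hn : (n : ℚ) = Algebra.norm ℚ x := hn
  have hn0 : n ≠ 0 := by
    rw [← Int.cast_ne_zero (α := ℚ), hn]
    exact Algebra.norm_ne_zero_iff.mpr h0
  have hn1 : |n| ≠ 1 := by
    rwa [← abs_norm_eq_one_iff hx, ← hn, ← Int.cast_abs, ← Int.cast_one, Int.cast_inj] at hu
  have hn2 : 2 ≤ |n| := by
    have := abs_pos.mpr hn0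
    omega
  refine le_trans ?_ (abs_norm_le_house_pow x)
  rw [← hn]
  exact_mod_cast hn2

theorem exists_embedding_eq {z : ℂ} (hz : Polynomial.aeval z (minpoly ℚ x) = 0) :
    ∃ σ : K →+* ℂ, σ x = z := by
  rw [← Set.mem_range, Embeddings.range_eval_eq_rootSet_minpoly]
  exact Polynomial.mem_rootSet.mpr ⟨minpoly.ne_zero (Algebra.IsIntegral.isIntegral x), hz⟩

theorem log_norm_embedding_le_log_house (h0 : x ≠ 0) (σ : K →+* ℂ) :
    Real.log ‖σ x‖ ≤ Real.log (NumberField.house x) :=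
  Real.log_le_log (norm_pos_iff.mpr ((map_ne_zero σ).mpr h0)) (norm_embedding_le_house x σ)

theorem heightIn_top_le_log_house (hx : IsAlgUnit x) (hinv : IsConjRoot ℚ x x⁻¹) :
    heightIn ∞ x ≤ Real.log (NumberField.house x) := by
  rw [hx.heightIn_eq_lpMean ENNReal.top_ne_zero]
  have hlog := Real.log_nonneg (one_le_house_of_isIntegral hx.isIntegral hx.ne_zero)
  refine lpMean_top_le hlog fun σ => abs_le'.mpr
    ⟨log_norm_embedding_le_log_house hx.ne_zero σ, ?_⟩
  obtain ⟨τ, hτ⟩ : ∃ τ : K →+* ℂ, τ x = σ x⁻¹ := exists_embedding_eq <| by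
    have := Polynomial.aeval_algHom_apply σ.toRatAlgHom x⁻¹ (minpoly ℚ x)
    rwa [hinv.aeval_eq_zero, map_zero] at this
  rw [← Real.log_inv, ← norm_inv, ← map_inv₀, ← hτ]
  exact log_norm_embedding_le_log_house hx.ne_zero τ

theorem norm_le_house_of_mem_roots (hx : IsIntegral ℤ x) {z : ℂ}
    (hz : z ∈ ((minpoly ℤ x).map (Int.castRingHom ℂ)).roots) : ‖z‖ ≤ NumberField.house x := by
  obtain ⟨σ, rfl⟩ : ∃ σ : K →+* ℂ, σ x = z := exists_embedding_eq <| by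
    rw [minpoly.isIntegrallyClosed_eq_field_fractions' ℚ hx, Polynomial.aeval_map_algebraMap]
    rw [Polynomial.aeval_def, ← Polynomial.eval_map]
    exact (Polynomial.mem_roots'.mp hz).2
  exact norm_embedding_le_house x σ

theorem mahlerMeasure_minpoly_le_house_pow (hx : IsIntegral ℤ x) (h0 : x ≠ 0) :
    ((minpoly ℤ x).map (Int.castRingHom ℂ)).mahlerMeasure ≤
      NumberField.house x ^ finrank ℚ K := by
  have hmonic := minpoly.monic hx
  have h1 := one_le_house_of_isIntegral hx h0
  have hdeg : (minpoly ℤ x).natDegree ≤ finrank ℚ K := by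
    rw [← hmonic.natDegree_map (algebraMap ℤ ℚ),
      ← minpoly.isIntegrallyClosed_eq_field_fractions' ℚ hx]
    exact minpoly.natDegree_le x
  set s := ((minpoly ℤ x).map (Int.castRingHom ℂ)).roots
  calc ((minpoly ℤ x).map (Int.castRingHom ℂ)).mahlerMeasure
      = (s.map fun z => max 1 ‖z‖).prod := by
        rw [Polynomial.mahlerMeasure_eq_leadingCoeff_mul_prod_roots,
          (hmonic.map _).leadingCoeff, norm_one, one_mul]
    _ ≤ (s.map fun _ => NumberField.house x).prod :=
        Multiset.prod_map_le_prod_map₀ _ _ (fun z _ => le_max_of_le_left zero_le_one)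
          fun z hz => max_le h1 (norm_le_house_of_mem_roots hx hz)
    _ = NumberField.house x ^ s.card := by rw [Multiset.map_const', Multiset.prod_replicate]
    _ ≤ NumberField.house x ^ finrank ℚ K := pow_le_pow_right₀ h1 <|
        (Polynomial.card_roots' _).trans <| Polynomial.natDegree_map_le.trans hdeg

theorem IsAlgUnit.abs_coeff_zero_minpoly (hx : IsAlgUnit x) : |(minpoly ℤ x).coeff 0| = 1 := by
  have hxi : IsIntegral ℚ x := Algebra.IsIntegral.isIntegral x
  have hpb := Algebra.PowerBasis.norm_gen_eq_coeff_zero_minpoly (adjoin.powerBasis hxi)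
  rw [adjoin.powerBasis_gen hxi, minpoly_gen,
    minpoly.isIntegrallyClosed_eq_field_fractions' ℚ hx.isIntegral, Polynomial.coeff_map] at hpb
  have hnorm := (abs_norm_eq_one_iff hx.isIntegral).mpr hx
  rw [Algebra.norm_eq_norm_adjoin ℚ x, hpb, abs_pow, abs_mul, abs_pow, abs_neg, abs_one, one_pow,
    one_mul, pow_eq_one_iff_of_nonneg (abs_nonneg _) finrank_pos.ne', eq_intCast] at hnorm
  exact_mod_cast hnorm

theorem isConjRoot_inv_of_minpoly_eq_C_mul_reverse {c : ℤ} (hx : IsIntegral ℤ x) (h0 : x ≠ 0)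
    (h : minpoly ℤ x = Polynomial.C c * (minpoly ℤ x).reverse) : IsConjRoot ℚ x x⁻¹ := by
  refine isConjRoot_of_aeval_eq_zero (Algebra.IsIntegral.isIntegral x) ?_
  let := invertibleOfNonzero h0
  have hrev : Polynomial.aeval x⁻¹ (minpoly ℤ x).reverse = 0 := by
    rw [← invOf_eq_inv x]
    exact Polynomial.eval₂_reverse_eq_zero_iff _ _ _ |>.mpr (minpoly.aeval ℤ x)
  rw [minpoly.isIntegrallyClosed_eq_field_fractions' ℚ hx, Polynomial.aeval_map_algebraMap, h,
    map_mul, hrev, mul_zero]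

theorem five_fourths_le_house_pow (hx : IsAlgUnit x) (hinv : ¬ IsConjRoot ℚ x x⁻¹) :
    5 / 4 ≤ NumberField.house x ^ (finrank ℚ K * 2) := by
  have h5 := five_le_four_mul_mahlerMeasure_sq (minpoly.monic hx.isIntegral)
    hx.abs_coeff_zero_minpoly
    (mt (isConjRoot_inv_of_minpoly_eq_C_mul_reverse hx.isIntegral hx.ne_zero) hinv)
  have hle := pow_le_pow_left₀ (Polynomial.mahlerMeasure_nonneg _)
    (mahlerMeasure_minpoly_le_house_pow hx.isIntegral hx.ne_zero) 2
  rw [pow_mul]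
  linarith

end House

section SchinzelZassenhaus

open NumberField Module IntermediateField

theorem one_add_div_le_of_le_mul_log {c H : ℝ} {d : ℕ} (hd : 0 < d) (hH : 0 < H)
    (h : c ≤ d * Real.log H) : 1 + c / d ≤ H := by
  have hdiv : c / d ≤ Real.log H := (div_le_iff₀' (Nat.cast_pos.mpr hd)).mpr h
  linarith [Real.log_le_sub_one_of_pos hH]

theorem min_le_finrank_mul_log_house {K : Type*} [Field K] [NumberField K] {x : K}
    (hx : IsIntegral ℤ x) (h0 : x ≠ 0) :
    min (finrank ℚ K * heightIn ∞ x) (min (Real.log 2) (Real.log (5 / 4) / 2)) ≤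
      finrank ℚ K * Real.log (NumberField.house x) := by
  by_cases hu : IsAlgUnit x
  · by_cases hinv : IsConjRoot ℚ x x⁻¹
    · refine (min_le_left _ _).trans ?_
      gcongr
      exact heightIn_top_le_log_house hu hinv
    · refine (min_le_right _ _).trans ((min_le_right _ _).trans ?_)
      have h := Real.log_le_log (by norm_num) (five_fourths_le_house_pow hu hinv)
      rw [Real.log_pow, Nat.cast_mul, Nat.cast_ofNat] at h
      linarith
  · refine (min_le_right _ _).trans ((min_le_left _ _).trans ?_)
    rw [← Real.log_pow]
    exact Real.log_le_log two_pos (two_le_house_pow_finrank hx h0 hu)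

theorem LpLehmerBound.schinzelZassenhaus (h : LpLehmerBound ∞) :
    SchinzelZassenhausConjecture := by
  obtain ⟨c, hc, hbound⟩ := h
  refine ⟨min c (min (Real.log 2) (Real.log (5 / 4) / 2)), lt_min hc
    (lt_min (Real.log_pos one_lt_two) (half_pos (Real.log_pos (by norm_num)))), ?_⟩
  intro α hα htor
  have h0 := gen_ne_zero α
  have hint : IsIntegral ℤ (AdjoinSimple.gen ℚ (α : Qbar)) :=
    (isIntegral_algHom_iff (algebraMap ℚ⟮(α : Qbar)⟯ Qbar).toIntAlgHom
      (algebraMap ℚ⟮(α : Qbar)⟯ Qbar).injective).mp hα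
  exact one_add_div_le_of_le_mul_log finrank_pos
    (zero_lt_one.trans_le (one_le_house_of_isIntegral hint h0))
    ((min_le_min_right _ (hbound α htor)).trans (min_le_finrank_mul_log_house hint h0))

end SchinzelZassenhaus

end ExtremalNorm

end

theorem theorem2_general :
    (∀ p : ENNReal, 1 ≤ p → ExtremalNorm.MinMahlerBound p → ExtremalNorm.LpLehmerBound p) ∧
    (ExtremalNorm.MinMahlerBound 1 → ExtremalNorm.LehmerConjecture) ∧
    (ExtremalNorm.MinMahlerBound ⊤ → ExtremalNorm.SchinzelZassenhausConjecture) :=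
  ⟨fun _ hp h => h.lpLehmerBound hp, fun h => (h.lpLehmerBound le_rfl).lehmerConjecture,
    fun h => (h.lpLehmerBound le_top).schinzelZassenhaus⟩

theorem theorem2 :
    (∀ p : ENNReal, 1 ≤ p → ExtremalNorm.ExtremalBound p → ExtremalNorm.LpLehmerBound p) ∧
    (ExtremalNorm.ExtremalBound 1 → ExtremalNorm.LehmerConjecture) ∧
    (ExtremalNorm.ExtremalBound ⊤ → ExtremalNorm.SchinzelZassenhausConjecture) := by
  obtain ⟨hLp, hLehmer, hSZ⟩ := theorem2_general
  exact ⟨fun p hp h => hLp p hp h.minMahlerBound, fun h => hLehmer h.minMahlerBound,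
    fun h => hSZ h.minMahlerBound⟩
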